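/- Let $k\ge 1$. Let $G$ be the graph on $\mathbb{Z}^k$ in which $x$ and $y$ are adjacent exactly when $\|x-y\|_\infty=\max_i|x_i-y_i|=1$, and for $A\subseteq\mathbb{Z}^k$ let $\partial A$ be the union of $A$ with the set of all neighbours of points of $A$, i.e. $\partial A=\{x\in\mathbb{Z}^k:\|x-a\|_\infty\le 1\text{ for some }a\in A\}$. Define $\prec$ on $\mathbb{Z}^k$ recursively. On $\mathbb{Z}^1=\mathbb{Z}$ it is the ordering $0\prec 1\prec -1\prec 2\prec -2\prec 3\prec\cdots$. For $k>1$ and $u\in\mathbb{Z}^k$ let $M(u)$ be the largest entry of $u$ with respect to the ordering $\prec$ of $\mathbb{Z}$, let $i_u=\min\{i:u_i=M(u)\}$, and let $u'\in\mathbb{Z}^{k-1}$ be $u$ with its $i_u$-th coordinate deleted. Then $u\prec v$ if and only if one of the following holds: (i) $M(u)\prec M(v)$; (ii) $M(u)=M(v)$ and $i_v<i_u$; (iii) $M(u)=M(v)$, $i_u=i_v$ and $u'\prec v'$ in $\mathbb{Z}^{k-1}$. An initial segment is a set $I\subseteq\mathbb{Z}^k$ such that $v\in I$ and $u\prec v$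 imply $u\in I$. Then $\prec$ is a well-ordering of $\mathbb{Z}^k$, and for every integer $n\ge 0$ there is exactly one initial segment with $n$ elements. If $A\subset\mathbb{Z}^k$ is finite and nonempty and $I$ is an initial segment with $|I|=|A|$, then $|\partial I|\le|\partial A|$. Consequently there are nested sets of minimal boundary: there are initial segments $S_0\subseteq S_1\subseteq S_2\subseteq\cdots$ with $|S_n|=n$ such that $|\partial S_n|\le|\partial A|$ for every $A\subset\mathbb{Z}^k$ with $|A|=n$. -/

import Mathlib

/-- Position in the list `0, 1, -1, 2, -2, 3, …` (counted from `0`). -/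
def intRank (a : ℤ) : ℕ := if 0 < a then 2 * a.natAbs - 1 else 2 * a.natAbs

/-- The well-ordering `0 ≺ 1 ≺ -1 ≺ 2 ≺ -2 ≺ ⋯` of `ℤ`. -/
def IntPrec (a b : ℤ) : Prop := intRank a < intRank b

theorem intRank_injective : Function.Injective intRank := by
  intro a b h
  unfold intRank at h
  split_ifs at h <;> omega

theorem exists_maxEntry {k : ℕ} (u : Fin (k + 1) → ℤ) :
    ∃ m : ℤ, (∃ i, u i = m) ∧ ∀ j, u j = m ∨ IntPrec (u j) m := by
  obtain ⟨i, -, hi⟩ := Finset.exists_max_image Finset.univ (fun j => intRank (u j))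
    ⟨0, Finset.mem_univ _⟩
  refine ⟨u i, ⟨i, rfl⟩, fun j => ?_⟩
  rcases (hi j (Finset.mem_univ j)).eq_or_lt with h | h
  · exact Or.inl (intRank_injective h)
  · exact Or.inr h

/-- `M(u)`: the `≺`-largest of the entries of `u`. -/
noncomputable def maxEntry {k : ℕ} (u : Fin (k + 1) → ℤ) : ℤ := (exists_maxEntry u).choose

theorem exists_eq_maxEntry {k : ℕ} (u : Fin (k + 1) → ℤ) :
    (Finset.univ.filter fun i => u i = maxEntry u).Nonempty := by
  obtain ⟨i, hi⟩ := (exists_maxEntry u).choose_spec.1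
  exact ⟨i, Finset.mem_filter.mpr ⟨Finset.mem_univ i, hi⟩⟩

/-- The least index `i` with `u i = M(u)`. -/
noncomputable def firstMax {k : ℕ} (u : Fin (k + 1) → ℤ) : Fin (k + 1) :=
  (Finset.univ.filter fun i => u i = maxEntry u).min' (exists_eq_maxEntry u)

/-- The recursive well-ordering `≺` of `ℤ^k`. In the last alternative the common first
maximal coordinate is deleted from both vectors. -/
def Prec : (k : ℕ) → (Fin k → ℤ) → (Fin k → ℤ) → Prop
  | 0, _, _ => False
  | 1, u, v => IntPrec (u 0) (v 0)
  | k + 2, u, v =>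
      IntPrec (maxEntry u) (maxEntry v) ∨
      (maxEntry u = maxEntry v ∧ firstMax v < firstMax u) ∨
      (maxEntry u = maxEntry v ∧ firstMax u = firstMax v ∧
        Prec (k + 1) (fun j => u ((firstMax u).succAbove j))
          (fun j => v ((firstMax v).succAbove j)))

/-- Initial segments of `(ℤ^k, ≺)`. -/
def IsInitialSegment {k : ℕ} (I : Set (Fin k → ℤ)) : Prop :=
  ∀ v ∈ I, ∀ u, Prec k u v → u ∈ I

/-- The graph on `ℤ^k` joining points at `ℓ∞`-distance `1`
(the norm of `Fin k → ℤ` is the sup norm). -/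
def linftyGraph (k : ℕ) : SimpleGraph (Fin k → ℤ) where
  Adj x y := ‖x - y‖ = 1
  symm := ⟨fun x y h => by rw [norm_sub_rev]; exact h⟩
  loopless := ⟨fun x h => by simp at h⟩

/-- `∂A`: the set `A` together with all its neighbours. -/
def vertexBoundary {k : ℕ} (A : Set (Fin k → ℤ)) : Set (Fin k → ℤ) :=
  A ∪ {x | ∃ a ∈ A, (linftyGraph k).Adj x a}

theorem mem_vertexBoundary_iff {k : ℕ} (A : Set (Fin k → ℤ)) (x : Fin k → ℤ) :
    x ∈ vertexBoundary A ↔ ∃ a ∈ A, ‖x - a‖ ≤ 1 := by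
  constructor
  · rintro (h | ⟨a, ha, h⟩)
    · exact ⟨x, h, by simp⟩
    · exact ⟨a, ha, le_of_eq h⟩
  · rintro ⟨a, ha, h⟩
    by_cases hx : x = a
    · exact Or.inl (hx ▸ ha)
    · refine Or.inr ⟨a, ha, le_antisymm h ?_⟩
      obtain ⟨i, hi⟩ := Function.ne_iff.mp hx
      refine le_trans ?_ (norm_le_pi_norm (x - a) i)
      rw [Pi.sub_apply, Int.norm_eq_abs]
      exact_mod_cast Int.one_le_abs (sub_ne_zero.mpr hi)

/-! Give a point of `ℤ^k` the weight `3 ^ (number of zero coordinates)`, and let `profile k n` be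
the total weight of the first `n` points. Moving each nonzero coordinate one step towards `0` maps
`∂I` into `I` when `I` is an initial segment, and a point has as many preimages in `ℤ^k` as its
weight; hence `|∂I| ≤ profile k |I|` (`card_boundaryFinset_le`). It remains to show `profile k |A| ≤
|∂A|` for every finite `A`, by induction on the dimension (`profile_card_le_card_boundaryFinset`).

In dimension `k + 1`, let `L_j` be the set of points over which `A` has more than `j` points. A
nonempty column of `∂A` has at least two points more than the longest column of `A` adjacent to it,
so `|∂A| ≥ ∑ |∂L_j| + 2 |∂L_0|`. By induction the right side is at least the weight of a down-set of
`ℕ^(k+1)` with `|A|` points, whose slices are initial segments of sizes `|L_j|`.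

Finally, a down-set weighs at least as much as the initial segment of its size
(`profile_card_le_sum_zeroWeight`). Cut off the slice where some coordinate attains the largest
value `h > 0` of all coordinates. If it has `s` points and `n` remain, then `s * h ≤ n` and `s ≤ (h
+ 1) ^ k`, so what is needed is `ShortIncrementBound` for `profile`. This follows from the recursion
`IsLayered` alone, by an induction on the dimension that also carries subadditivity and
`QuasiCubeEndsMinimal`. -/

/-! ### Arithmetic of quasi-cubes -/

/-- The number of points of a box in `k` dimensions with `i` sides equal to `m` and the other
sides equal to `m + 1`. -/
def quasiCube (k m i : ℕ) : ℕ := m ^ i * (m + 1) ^ (k - i)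

theorem quasiCube_zero_right (k m : ℕ) : quasiCube k m 0 = (m + 1) ^ k := by
  simp [quasiCube]

theorem quasiCube_self (k m : ℕ) : quasiCube k m k = m ^ k := by
  simp [quasiCube]

theorem quasiCube_succ_succ (k m i : ℕ) :
    quasiCube (k + 1) m (i + 1) = m * quasiCube k m i := by
  simp only [quasiCube, Nat.add_sub_add_right]; ring

theorem quasiCube_succ {k i : ℕ} (m : ℕ) (hi : i ≤ k) :
    quasiCube (k + 1) m i = (m + 1) * quasiCube k m i := by
  simp only [quasiCube, show k + 1 - i = (k - i) + 1 by omega]; ring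

/-- The layer with index `i + 1` ends where the layer with index `i` begins, so the layers tile the
integers from `1` on. -/
theorem quasiCube_step {k i : ℕ} (m : ℕ) (hi : i < k) :
    (m + 1) * quasiCube k m (i + 1) = m * quasiCube k m i := by
  rw [← quasiCube_succ m hi, quasiCube_succ_succ]

theorem quasiCube_antitone {k i j : ℕ} (m : ℕ) (hij : i ≤ j) (hj : j ≤ k) :
    quasiCube k m j ≤ quasiCube k m i := by
  have h : k - i = (j - i) + (k - j) := by omega
  have h' : j = i + (j - i) := by omega
  unfold quasiCube
  rw [h, pow_add, ← mul_assoc]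
  nth_rw 1 [h']
  rw [pow_add]
  gcongr
  omega

theorem pow_le_quasiCube {k i : ℕ} (m : ℕ) (hi : i ≤ k) : m ^ k ≤ quasiCube k m i := by
  rw [← quasiCube_self]; exact quasiCube_antitone m hi le_rfl

theorem quasiCube_le_pow {k i : ℕ} (m : ℕ) (hi : i ≤ k) : quasiCube k m i ≤ (m + 1) ^ k := by
  rw [← quasiCube_zero_right]; exact quasiCube_antitone m (Nat.zero_le _) hi

/-- Every integer at least two lies in a layer between two consecutive quasi-cubes. -/
theorem exists_layer (k : ℕ) {N : ℕ} (hN : 2 ≤ N) :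
    ∃ m i, 1 ≤ m ∧ i ≤ k ∧ m * quasiCube k m i < N ∧ N ≤ (m + 1) * quasiCube k m i := by
  have hex : ∃ a, N ≤ a ^ (k + 1) := ⟨N, Nat.le_self_pow (by omega) N⟩
  classical
  obtain ⟨a, ha, hmin⟩ : ∃ a, N ≤ a ^ (k + 1) ∧ ∀ b < a, b ^ (k + 1) < N :=
    ⟨Nat.find hex, Nat.find_spec hex, fun b hb => not_le.mp (Nat.find_min hex hb)⟩
  have ha2 : 2 ≤ a := by
    by_contra h
    have : a ^ (k + 1) ≤ 1 := Nat.pow_le_one_iff (by omega) |>.mpr (by omega)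
    omega
  obtain ⟨m, rfl⟩ : ∃ m, a = m + 1 := ⟨a - 1, by omega⟩
  let p : ℕ → Prop := fun i => N ≤ (m + 1) * quasiCube k m i
  have h0 : p 0 := by
    simp only [p, quasiCube_zero_right]; rw [← pow_succ']; exact ha
  refine ⟨m, Nat.findGreatest p k, by omega, Nat.findGreatest_le k, ?_,
    Nat.findGreatest_spec (P := p) (Nat.zero_le k) h0⟩
  rcases (Nat.findGreatest_le (P := p) k).eq_or_lt with h | h
  · rw [h, quasiCube_self, ← pow_succ']
    exact hmin m (by omega)
  · rw [← quasiCube_step m h]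
    exact not_le.mp (Nat.findGreatest_is_greatest (P := p) (Nat.lt_succ_self _) h)

/-- A layer that starts before another one ends does not come after it, and layers never become
narrower. -/
theorem quasiCube_le_of_layer {k m i m' i' : ℕ} (hi : i ≤ k) (hi' : i' ≤ k)
    (h : m' * quasiCube k m' i' < (m + 1) * quasiCube k m i) :
    quasiCube k m' i' ≤ quasiCube k m i := by
  rcases lt_trichotomy m' m with hm | rfl | hm
  · exact (quasiCube_le_pow m' hi').trans
      ((Nat.pow_le_pow_left hm k).trans (pow_le_quasiCube m hi))
  · by_contra hlt
    have hii : i' < i := by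
      by_contra hc
      exact hlt (quasiCube_antitone m' (not_lt.mp hc) hi')
    obtain ⟨j, rfl⟩ : ∃ j, i = j + 1 := ⟨i - 1, by omega⟩
    rw [quasiCube_step m' hi] at h
    have := Nat.mul_le_mul_left m' (quasiCube_antitone m' (Nat.lt_succ_iff.mp hii)
      (show j ≤ k by omega))
    omega
  · exfalso
    have h1 : m' ^ (k + 1) ≤ m' * quasiCube k m' i' := by
      rw [pow_succ']; exact Nat.mul_le_mul_left _ (pow_le_quasiCube m' hi')
    have h2 : (m + 1) * quasiCube k m i ≤ (m + 1) ^ (k + 1) := by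
      rw [pow_succ']; exact Nat.mul_le_mul_left _ (quasiCube_le_pow m hi)
    have h3 := Nat.pow_le_pow_left (show m + 1 ≤ m' from hm) (k + 1)
    omega

/-! ### Inequalities for layered functions -/

/-- A family of functions `F k` (one for each dimension) such that in dimension `k + 1` the
function grows, between consecutive quasi-cubes, in the way `F k` grows from `0`. -/
structure IsLayered (F : ℕ → ℕ → ℕ) : Prop where
  zero : ∀ k, F k 0 = 0
  one_le : ∀ k, F k 1 ≤ F (k + 1) 1
  dim_zero : ∀ n, F 0 (n + 1) = 1
  layer : ∀ k m i r, 1 ≤ m → i ≤ k → r ≤ quasiCube k m i →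
    F (k + 1) (m * quasiCube k m i + r) = F (k + 1) (m * quasiCube k m i) + F k r

/-- Among the increments of a given length of `F k` on `[0, Q]` the last is the smallest, for
every quasi-cube `Q`. -/
def QuasiCubeEndsMinimal (F : ℕ → ℕ → ℕ) (k : ℕ) : Prop :=
  ∀ m i t x d, 1 ≤ m → i ≤ k → t + x + d = quasiCube k m i →
    F k (t + x + d) + F k t ≤ F k (t + x) + F k (t + d)

/-- Short increments in dimension `k + 1` are bounded by initial increments in dimension `k`. -/
def ShortIncrementBound (F : ℕ → ℕ → ℕ) (k : ℕ) : Prop :=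
  ∀ m n s, 1 ≤ m → s * m ≤ n → s ≤ (m + 1) ^ k → F (k + 1) (n + s) ≤ F (k + 1) n + F k s

namespace IsLayered

variable {F : ℕ → ℕ → ℕ} {k : ℕ}

/-- With `P = quasiCube k m i`, no increment of length `y` of `F (k + 1)` on `[0, (m + 1) * P]` is
below the last one of `F k` on `[0, P]`. The increment is cut where its final layer begins; the part
in that layer is an increment of `F k`. -/
theorem increment_ge (hF : IsLayered F) (hS : ∀ t x, F k (t + x) ≤ F k t + F k x)
    (hE : QuasiCubeEndsMinimal F k) {m i : ℕ} (hm : 1 ≤ m) (hi : i ≤ k) (y : ℕ) :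
    ∀ u z, y + z = quasiCube k m i → u + y ≤ (m + 1) * quasiCube k m i →
      F (k + 1) u + F k (y + z) ≤ F (k + 1) (u + y) + F k z := by
  induction y using Nat.strong_induction_on with
  | _ y ih =>
    intro u z hyz huy
    rcases Nat.eq_zero_or_pos y with rfl | hy
    · simp
    rcases Nat.lt_or_ge (u + y) 2 with h2 | h2
    · obtain rfl : u = 0 := by omega
      obtain rfl : y = 1 := by omega
      have h1 := hS 1 z
      have h3 := hF.one_le k
      have h4 := hF.zero (k + 1)
      simp only [zero_add]
      omega
    obtain ⟨m', i', hm', hi', hlt, hle⟩ := exists_layer k h2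
    have hPP : quasiCube k m' i' ≤ quasiCube k m i :=
      quasiCube_le_of_layer hi hi' (hlt.trans_le huy)
    obtain ⟨r, hr⟩ : ∃ r, u + y = m' * quasiCube k m' i' + r :=
      ⟨_, (Nat.add_sub_cancel' hlt.le).symm⟩
    have hrP : r ≤ quasiCube k m' i' := by
      rw [hr, add_mul, one_mul] at hle; omega
    have hL := hF.layer k m' i' r hm' hi' hrP
    rw [hr, hL]
    rcases le_or_gt y r with hyr | hyr
    -- The increment lies in one layer, so it is an increment of `F k` inside `[0, P]`.
    · obtain ⟨t, rfl⟩ : ∃ t, r = t + y := ⟨r - y, by omega⟩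
      obtain ⟨d, hd⟩ : ∃ d, z = t + d := ⟨z - t, by omega⟩
      have hu : u = m' * quasiCube k m' i' + t := by omega
      have hL' := hF.layer k m' i' t hm' hi' (by omega)
      have := hE m i t y d hm hi (by omega)
      rw [hu, hL', show y + z = t + y + d by omega, hd]
      omega
    -- The lower part, of length `y'`, is matched with the top of `[0, P]` by induction; the upper
    -- part is worth `F k r`, which by subadditivity is at least the increment from `z` to `r + z`.
    · obtain ⟨y', rfl⟩ : ∃ y', y = y' + r := ⟨y - r, by omega⟩
      have h1 := ih y' (by omega) u (r + z) (by omega) (by omega)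
      rw [show u + y' = m' * quasiCube k m' i' by omega] at h1
      have h2 := hS r z
      rw [show y' + r + z = y' + (r + z) by omega]
      omega

/-- The last layer of the quasi-cube has width `P` and repeats `F k`, so increments of length at
most `P` are covered by `increment_ge`. A longer one gives up a piece of length `P` against the
whole last layer; the rest is compared inside the preceding quasi-cube. -/
theorem quasiCubeEndsMinimal_succ (hF : IsLayered F)
    (hS : ∀ t x, F k (t + x) ≤ F k t + F k x) (hE : QuasiCubeEndsMinimal F k) :
    QuasiCubeEndsMinimal F (k + 1) := by
  suffices H : ∀ Q m i t x d, 1 ≤ m → i ≤ k + 1 → Q = quasiCube (k + 1) m i → t + x + d = Q →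
      F (k + 1) (t + x + d) + F (k + 1) t ≤ F (k + 1) (t + x) + F (k + 1) (t + d) from
    fun m i t x d hm hi h => H _ m i t x d hm hi rfl h
  intro Q
  induction Q using Nat.strong_induction_on with
  | _ Q ih =>
    intro m i t x d hm hi hQ hsum
    rcases Nat.eq_zero_or_pos x with rfl | hx
    · simp [add_comm]
    rcases Nat.eq_zero_or_pos d with rfl | hd
    · simp
    have main : ∀ m i, 1 ≤ m → i ≤ k → Q = (m + 1) * quasiCube k m i →
        F (k + 1) (t + x + d) + F (k + 1) t ≤ F (k + 1) (t + x) + F (k + 1) (t + d) := by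
      intro m i hm hi hQ
      have hQ' : Q = m * quasiCube k m i + quasiCube k m i := by rw [hQ]; ring
      have hP : 0 < quasiCube k m i :=
        (pow_pos (show 0 < m from hm) k).trans_le (pow_le_quasiCube m hi)
      have hLQ := hF.layer k m i _ hm hi le_rfl
      rw [hsum, hQ', hLQ]
      rcases le_total x (quasiCube k m i) with hxP | hxP
      · obtain ⟨z, hz⟩ := Nat.exists_eq_add_of_le hxP
        have h1 := hF.increment_ge hS hE hm hi x t z hz.symm (by omega)
        have h2 := hF.layer k m i z hm hi (by omega)
        rw [show t + d = m * quasiCube k m i + z by omega, h2]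
        rw [← hz] at h1
        omega
      · obtain ⟨x', rfl⟩ := Nat.exists_eq_add_of_le hxP
        have h1 := hF.increment_ge hS hE hm hi (quasiCube k m i) (t + x') 0 rfl (by omega)
        have h2 := ih (m * quasiCube k m i) (by omega) m (i + 1) t x' d hm (by omega)
          (quasiCube_succ_succ k m i).symm (by omega)
        rw [hF.zero, add_zero, add_zero] at h1
        rw [show t + x' + d = m * quasiCube k m i by omega] at h2
        rw [show t + (quasiCube k m i + x') = t + x' + quasiCube k m i by omega]
        omega
    rcases Nat.lt_or_ge k i with hik | hik
    · obtain rfl : i = k + 1 := by omega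
      rw [quasiCube_self] at hQ
      have hm2 : 2 ≤ m := by
        by_contra h
        obtain rfl : m = 1 := by omega
        rw [one_pow] at hQ
        omega
      -- A full cube of side `m` ends the layer with index `0` of the cube of side `m - 1`.
      obtain ⟨m, rfl⟩ : ∃ m', m = m' + 1 := ⟨m - 1, by omega⟩
      exact main m 0 (by omega) (Nat.zero_le _) (by rw [hQ, quasiCube_zero_right, pow_succ'])
    · exact main m i hm hik (by rw [hQ, quasiCube_succ m hik])

/-- If `n` and `n + s` share a layer, subadditivity of `F k` suffices. Otherwise a layer boundary `a
* P` lies strictly between them, and the width of the layer ending there is compared with `s`. -/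
theorem shortIncrementBound_of (hF : IsLayered F)
    (hS : ∀ t x, F k (t + x) ≤ F k t + F k x) (hE : QuasiCubeEndsMinimal F k)
    (hL : ∀ l, k = l + 1 → ShortIncrementBound F l) : ShortIncrementBound F k := by
  intro m n s hm hsn hs
  rcases Nat.eq_zero_or_pos s with rfl | hs0
  · simp
  have hsn' : s ≤ n := (Nat.le_mul_of_pos_right s hm).trans hsn
  obtain ⟨a, i, ha, hi, hlt, hle⟩ := exists_layer k (show 2 ≤ n + s by omega)
  set P := quasiCube k a i with hPdef
  rcases le_or_gt (a * P) n with hn | hn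
  · obtain ⟨r, rfl⟩ := Nat.exists_eq_add_of_le hn
    rw [add_mul, one_mul] at hle
    have h1 := hF.layer k a i r ha hi (by omega)
    have h2 := hF.layer k a i (r + s) ha hi (by omega)
    have h3 := hS r s
    rw [add_assoc, h2, h1]
    omega
  obtain ⟨t, ht⟩ := Nat.exists_eq_add_of_le hlt.le
  have htP : t ≤ P := by rw [ht, add_mul, one_mul] at hle; omega
  have hLt := hF.layer k a i t ha hi htP
  rw [ht, hLt]
  -- The layer ending at `a * P` has width at least `s`, hence contains `n`. Its final piece has
  -- length `s - t` and is worth no more than the increment of `F k` from `t` to `s`.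
  have endCase : ∀ b j, 1 ≤ b → j ≤ k → b * quasiCube k b j + quasiCube k b j = a * P →
      s ≤ quasiCube k b j → F (k + 1) (a * P) + F k t ≤ F (k + 1) n + F k s := by
    intro b j hb hj hbj hsP
    obtain ⟨r, rfl⟩ := Nat.exists_eq_add_of_le (show b * quasiCube k b j ≤ n by omega)
    obtain ⟨x, hx⟩ := Nat.exists_eq_add_of_le (show r ≤ quasiCube k b j by omega)
    have hst : s = t + x := by omega
    obtain ⟨d, hd⟩ := Nat.exists_eq_add_of_le (show t ≤ r by omega)
    have h1 := hF.layer k b j _ hb hj le_rfl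
    have h2 := hF.layer k b j r hb hj (by omega)
    have h3 := hE b j t x d hb hj (by omega)
    rw [← hbj, h1, h2]
    rw [show t + x + d = quasiCube k b j by omega, ← hd, ← hst] at h3
    omega
  rcases hi.eq_or_lt with rfl | hik
  · have hP : P = a ^ i := quasiCube_self i a
    have ha2 : 2 ≤ a := by
      by_contra h
      obtain rfl : a = 1 := by omega
      rw [hP, one_pow] at hn
      omega
    obtain ⟨b, rfl⟩ : ∃ b, a = b + 1 := ⟨a - 1, by omega⟩
    refine endCase b 0 (by omega) (Nat.zero_le _) ?_ ?_
    · rw [quasiCube_zero_right, hP]; ring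
    · rw [quasiCube_zero_right, ← hP]
      rcases Nat.lt_or_ge m (b + 1) with hmb | hmb
      · rw [hP]; exact hs.trans (Nat.pow_le_pow_left hmb i)
      · have h1 : s * (b + 1) < P * (b + 1) := by
          calc s * (b + 1) ≤ s * m := Nat.mul_le_mul_left s hmb
            _ ≤ n := hsn
            _ < (b + 1) * P := hn
            _ = P * (b + 1) := mul_comm _ _
        exact (Nat.lt_of_mul_lt_mul_right h1).le
  · have hstep : (a + 1) * quasiCube k a (i + 1) = a * P := quasiCube_step a hik
    rw [add_mul, one_mul] at hstep
    rcases le_or_gt s (quasiCube k a (i + 1)) with hsP | hsP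
    · exact endCase a (i + 1) ha hik hstep hsP
    -- Now `s` exceeds the width `a * p` of the preceding layer, but `s < P = (a + 1) * p`. Writing
    -- `s = a * p + q` and `n = a * (a * p) + r`, both sides contain `F k (a * p)`, and the claim
    -- reduces to `F k (r + q) ≤ F k r + F l q`: the bound two dimensions down from `F (k + 1)`,
    -- with `q * a ≤ r`.
    obtain ⟨l, rfl⟩ : ∃ l, k = l + 1 := ⟨k - 1, by omega⟩
    have ham : a ≤ m := by
      by_contra h
      have h1 := Nat.pow_le_pow_left (show m + 1 ≤ a by omega) (l + 1)
      have h2 := pow_le_quasiCube a (show i + 1 ≤ l + 1 from hik)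
      omega
    have hsa : s * a ≤ n := (Nat.mul_le_mul_left s ham).trans hsn
    have hil : i ≤ l := by omega
    set p := quasiCube l a i with hp
    have hP' : quasiCube (l + 1) a (i + 1) = a * p := quasiCube_succ_succ l a i
    have hPe : P = a * p + p := by rw [hPdef, quasiCube_succ a hil]; ring
    rw [hP'] at hsP hstep
    obtain ⟨q, rfl⟩ := Nat.exists_eq_add_of_le hsP.le
    have hsP2 : a * p + q < P := by
      have : (a * p + q) * a < P * a := by rw [mul_comm P]; omega
      exact Nat.lt_of_mul_lt_mul_right this
    have hqa : a * (a * p) + q * a ≤ n := by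
      calc _ = (a * p + q) * a := by ring
        _ ≤ n := hsa
    obtain ⟨r, rfl⟩ := Nat.exists_eq_add_of_le (show a * (a * p) ≤ n by omega)
    have htr : t = r + q := by omega
    have h1 := hF.layer (l + 1) a (i + 1) (a * p) ha hik hP'.ge
    have h2 := hF.layer (l + 1) a (i + 1) r ha hik (by rw [hP']; omega)
    rw [hP'] at h1 h2
    have h3 := hF.layer l a i q ha hil (by omega)
    have h4 := hL l rfl a r q ha (by omega)
      ((show q ≤ p by omega).trans (quasiCube_le_pow a hil))
    rw [← hp] at h3
    rw [htr, ← hstep, h1, h2, h3]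
    omega

/-- The part `r` of `x` in its last layer satisfies `r * m ≤ t + m * Q` with `Q` the layer width, so
it can be removed by the short increment bound; the rest of `x` is handled by induction. -/
theorem subadditive_succ (hF : IsLayered F) (hL : ShortIncrementBound F k) (t x : ℕ) :
    F (k + 1) (t + x) ≤ F (k + 1) t + F (k + 1) x := by
  induction x using Nat.strong_induction_on with
  | _ x ih =>
    rcases Nat.eq_zero_or_pos x with rfl | hx
    · simp
    rcases Nat.lt_or_ge x 2 with h2 | h2
    · obtain rfl : x = 1 := by omega
      rcases Nat.eq_zero_or_pos t with rfl | ht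
      · simp
      have h1 := hL 1 t 1 le_rfl (by omega) (Nat.one_le_pow _ _ (by omega))
      have := hF.one_le k
      omega
    obtain ⟨m, i, hm, hi, hlt, hle⟩ := exists_layer k h2
    obtain ⟨r, rfl⟩ := Nat.exists_eq_add_of_le hlt.le
    have hr : r ≤ quasiCube k m i := by rw [add_mul, one_mul] at hle; omega
    have h1 := ih _ hlt
    have h2 := hL m (t + m * quasiCube k m i) r hm
      (by have := Nat.mul_le_mul_left m hr; rw [mul_comm r]; omega)
      (hr.trans (quasiCube_le_pow m hi))
    rw [hF.layer k m i r hm hi hr, ← add_assoc]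
    omega

theorem subadditive_and_endsMinimal (hF : IsLayered F) (k : ℕ) :
    (∀ t x, F k (t + x) ≤ F k t + F k x) ∧ QuasiCubeEndsMinimal F k ∧
      ShortIncrementBound F k := by
  induction k with
  | zero =>
    have hS : ∀ t x, F 0 (t + x) ≤ F 0 t + F 0 x := by
      intro t x
      rcases t with _ | t
      · simp
      · rw [show t + 1 + x = (t + x) + 1 by omega, hF.dim_zero, hF.dim_zero]; omega
    have hE : QuasiCubeEndsMinimal F 0 := by
      intro m i t x d _ hi h
      obtain rfl : i = 0 := by omega
      rw [quasiCube_self, pow_zero] at h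
      rcases Nat.eq_zero_or_pos x with rfl | hx
      · simp [add_comm]
      · obtain rfl : d = 0 := by omega
        simp
    exact ⟨hS, hE, hF.shortIncrementBound_of hS hE (fun l hl => by omega)⟩
  | succ k ih =>
    obtain ⟨hS, hE, hL⟩ := ih
    have hS' := hF.subadditive_succ hL
    have hE' := hF.quasiCubeEndsMinimal_succ hS hE
    refine ⟨hS', hE', hF.shortIncrementBound_of hS' hE' fun l hl => ?_⟩
    obtain rfl : k = l := by omega
    exact hL

theorem shortIncrementBound (hF : IsLayered F) (k : ℕ) : ShortIncrementBound F k :=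
  (hF.subadditive_and_endsMinimal k).2.2

end IsLayered

/-! ### The ordering of `ℤ^k` -/

theorem intRank_surjective : Function.Surjective intRank := by
  intro n
  rcases Nat.even_or_odd' n with ⟨c, rfl | rfl⟩
  · refine ⟨-(c : ℤ), ?_⟩
    unfold intRank
    split_ifs <;> omega
  · refine ⟨(c : ℤ) + 1, ?_⟩
    unfold intRank
    split_ifs <;> omega

theorem intRank_eq_zero {a : ℤ} : intRank a = 0 ↔ a = 0 := by
  unfold intRank
  split_ifs <;> omega

/-- `intRank` as an equivalence. -/
noncomputable def intRankEquiv : ℤ ≃ ℕ :=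
  Equiv.ofBijective intRank ⟨intRank_injective, intRank_surjective⟩

theorem intRank_intRankEquiv_symm (n : ℕ) : intRank (intRankEquiv.symm n) = n :=
  intRankEquiv.apply_symm_apply n

section MaxEntry

variable {k : ℕ}

theorem intRank_le_maxEntry (u : Fin (k + 1) → ℤ) (j : Fin (k + 1)) :
    intRank (u j) ≤ intRank (maxEntry u) := by
  rcases (exists_maxEntry u).choose_spec.2 j with h | h
  · exact (congrArg intRank h).le
  · exact (show intRank (u j) < _ from h).le

theorem apply_firstMax (u : Fin (k + 1) → ℤ) : u (firstMax u) = maxEntry u :=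
  (Finset.mem_filter.mp (Finset.min'_mem _ (exists_eq_maxEntry u))).2

theorem firstMax_le {u : Fin (k + 1) → ℤ} {j : Fin (k + 1)} (h : u j = maxEntry u) :
    firstMax u ≤ j :=
  Finset.min'_le _ _ (Finset.mem_filter.mpr ⟨Finset.mem_univ j, h⟩)

theorem intRank_lt_of_lt_firstMax {u : Fin (k + 1) → ℤ} {j : Fin (k + 1)} (h : j < firstMax u) :
    intRank (u j) < intRank (maxEntry u) :=
  (intRank_le_maxEntry u j).lt_of_ne fun he => absurd (firstMax_le (intRank_injective he)) h.not_ge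

theorem maxEntry_eq {u : Fin (k + 1) → ℤ} {i : Fin (k + 1)}
    (h : ∀ j, intRank (u j) ≤ intRank (u i)) : maxEntry u = u i :=
  intRank_injective (le_antisymm (by rw [← apply_firstMax]; exact h _) (intRank_le_maxEntry u i))

theorem firstMax_eq {u : Fin (k + 1) → ℤ} {i : Fin (k + 1)}
    (h : ∀ j, intRank (u j) ≤ intRank (u i)) (hlt : ∀ j < i, intRank (u j) < intRank (u i)) :
    firstMax u = i := by
  have hM := maxEntry_eq h
  refine le_antisymm (firstMax_le hM.symm) (not_lt.mp fun hc => ?_)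
  have := hlt _ hc
  rw [apply_firstMax u, hM] at this
  exact lt_irrefl _ this

theorem prec_succ_iff (u v : Fin (k + 1) → ℤ) :
    Prec (k + 1) u v ↔ intRank (maxEntry u) < intRank (maxEntry v) ∨
      (maxEntry u = maxEntry v ∧ firstMax v < firstMax u) ∨
      (maxEntry u = maxEntry v ∧ firstMax u = firstMax v ∧
        Prec k ((firstMax u).removeNth u) ((firstMax v).removeNth v)) := by
  cases k with
  | zero =>
    have h0 : ∀ w : Fin 1 → ℤ, firstMax w = 0 := fun w => Subsingleton.elim (α := Fin 1) _ _
    have h : ∀ w : Fin 1 → ℤ, maxEntry w = w 0 := fun w => by rw [← apply_firstMax w, h0]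
    have h' : ¬ firstMax v < firstMax u := by rw [h0, h0]; exact lt_irrefl _
    simp [Prec, IntPrec, h, h']
  | succ k => rfl

end MaxEntry

theorem isWellOrder_prec (k : ℕ) : IsWellOrder (Fin k → ℤ) (Prec k) := by
  induction k with
  | zero =>
    exact
      { trichotomous := fun a b _ _ => Subsingleton.elim a b
        wf := ⟨fun a => ⟨a, fun _ h => h.elim⟩⟩ }
  | succ k ih =>
    let f : (Fin (k + 1) → ℤ) → ℕ × Fin (k + 1) × (Fin k → ℤ) := fun u =>
      (intRank (maxEntry u), firstMax u, (firstMax u).removeNth u)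
    have hf : Function.Injective f := by
      intro u v h
      simp only [f, Prod.mk.injEq] at h
      obtain ⟨h1, h2, h3⟩ := h
      have h1 := intRank_injective h1
      rw [← Fin.insertNth_self_removeNth (firstMax u) u,
        ← Fin.insertNth_self_removeNth (firstMax v) v, apply_firstMax u, apply_firstMax v, h3, h2, h1]
    -- The index is compared in reverse, which is harmless since `Fin (k + 1)` is finite.
    let e : Prec (k + 1) ↪r Prod.Lex (· < ·) (Prod.Lex (· > ·) (Prec k)) :=
      ⟨⟨f, hf⟩, by
        intro u v
        rw [prec_succ_iff]
        simp only [Function.Embedding.coeFn_mk, f, Prod.lex_def, intRank_injective.eq_iff,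
          gt_iff_lt]
        tauto⟩
    exact e.isWellOrder

theorem prec_trichotomy {k : ℕ} (u v : Fin k → ℤ) : Prec k u v ∨ u = v ∨ Prec k v u :=
  have := isWellOrder_prec k
  trichotomous_of (Prec k) u v

/-! ### Finite initial segments -/

/-- The initial segment formed by the first `n` points of `ℤ^k` (by all points, if there are
fewer than `n` of them). -/
def seg (k : ℕ) : ℕ → Set (Fin k → ℤ)
  | 0 => ∅
  | n + 1 => {v | ∀ u, Prec k u v → u ∈ seg k n}

theorem isInitialSegment_seg (k n : ℕ) : IsInitialSegment (seg k n) := by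
  induction n with
  | zero => exact fun v hv => hv.elim
  | succ n ih =>
    intro v hv u huv w hwu
    exact ih u (hv u huv) w hwu

theorem seg_subset_succ (k n : ℕ) : seg k n ⊆ seg k (n + 1) :=
  fun v hv u huv => isInitialSegment_seg k n v hv u huv

theorem seg_mono (k : ℕ) : Monotone (seg k) := monotone_nat_of_le_succ (seg_subset_succ k)

theorem seg_succ_eq_insert {k n : ℕ} {v : Fin k → ℤ} (hv : v ∈ seg k (n + 1))
    (hv' : v ∉ seg k n) : seg k (n + 1) = insert v (seg k n) := by
  refine Set.Subset.antisymm (fun w hw => ?_) (Set.insert_subset hv (seg_subset_succ k n))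
  rcases prec_trichotomy v w with h | h | h
  · exact absurd (hw v h) hv'
  · exact Or.inl h.symm
  · exact Or.inr (hv w h)

theorem seg_succ_eq_or (k n : ℕ) :
    seg k (n + 1) = seg k n ∨ ∃ v ∉ seg k n, seg k (n + 1) = insert v (seg k n) := by
  by_cases h : seg k (n + 1) ⊆ seg k n
  · exact Or.inl (h.antisymm (seg_subset_succ k n))
  · obtain ⟨v, hv, hv'⟩ := Set.not_subset.mp h
    exact Or.inr ⟨v, hv', seg_succ_eq_insert hv hv'⟩

theorem finite_seg (k n : ℕ) : (seg k n).Finite := by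
  induction n with
  | zero => exact Set.finite_empty
  | succ n ih =>
    rcases seg_succ_eq_or k n with h | ⟨v, -, h⟩ <;> rw [h]
    · exact ih
    · exact ih.insert v

theorem ncard_seg_add_le (k n d : ℕ) : (seg k (n + d)).ncard ≤ (seg k n).ncard + d := by
  induction d with
  | zero => simp
  | succ d ih =>
    rw [← add_assoc]
    rcases seg_succ_eq_or k (n + d) with h | ⟨v, -, h⟩ <;> rw [h]
    · omega
    · have := Set.ncard_insert_le v (seg k (n + d))
      omega

theorem ncard_seg_le (k n : ℕ) : (seg k n).ncard ≤ n := by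
  have := ncard_seg_add_le k 0 n
  rw [zero_add] at this
  simpa [seg] using this

theorem ncard_seg_of_le {k n r : ℕ} (hn : (seg k n).ncard = n) (hr : r ≤ n) :
    (seg k r).ncard = r := by
  obtain ⟨d, rfl⟩ := Nat.exists_eq_add_of_le hr
  have h1 := ncard_seg_add_le k r d
  have h2 := ncard_seg_le k r
  omega

theorem ncard_seg {k : ℕ} (hk : 1 ≤ k) (n : ℕ) : (seg k n).ncard = n := by
  have := isWellOrder_prec k
  have : Nonempty (Fin k) := ⟨⟨0, hk⟩⟩
  induction n with
  | zero => simp [seg]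
  | succ n ih =>
    obtain ⟨v, hv, hmin⟩ := (IsWellFounded.wf (r := Prec k)).has_min (seg k n)ᶜ
      (finite_seg k n).infinite_compl.nonempty
    have hv1 : v ∈ seg k (n + 1) := fun u huv => by
      by_contra hu
      exact hmin u hu huv
    rw [seg_succ_eq_insert hv1 hv, Set.ncard_insert_of_notMem hv (finite_seg k n), ih]

/-- Deleting the greatest element leaves an initial segment with one point fewer. -/
theorem IsInitialSegment.eq_seg {k : ℕ} {n : ℕ} : ∀ {I : Set (Fin k → ℤ)},
    IsInitialSegment I → I.Finite → I.ncard = n → I = seg k n := by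
  have := isWellOrder_prec k
  induction n with
  | zero => exact fun _ hfin h => (Set.ncard_eq_zero hfin).mp h
  | succ n ih =>
    intro I hI hfin hn
    have hne : I.Nonempty := Set.nonempty_of_ncard_ne_zero (by omega)
    obtain ⟨v, hv, hmax⟩ : ∃ v ∈ I, ∀ u ∈ I, ¬ Prec k v u := by
      have : Finite I := hfin
      obtain ⟨v, -, hv⟩ := (Finite.wellFounded_of_trans_of_irrefl
        (fun a b : I => Prec k b.1 a.1)).has_min Set.univ ⟨⟨_, hne.some_mem⟩, trivial⟩
      exact ⟨v.1, v.2, fun u hu => hv ⟨u, hu⟩ trivial⟩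
    have hI' : IsInitialSegment (I \ {v}) := by
      rintro w ⟨hw, hwv⟩ u huw
      refine ⟨hI w hw u huw, ?_⟩
      rintro rfl
      exact hmax w hw huw
    have hseg := ih hI' (hfin.subset Set.sdiff_subset)
      (by rw [Set.ncard_sdiff_singleton_of_mem hv]; omega)
    ext u
    change u ∈ I ↔ ∀ w, Prec k w u → w ∈ seg k n
    rw [← hseg]
    constructor
    · intro hu w hwu
      refine ⟨hI u hu w hwu, ?_⟩
      rintro rfl
      exact hmax u hu hwu
    · intro h
      rcases prec_trichotomy u v with huv | rfl | huv
      · exact hI v hv u huv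
      · exact hv
      · exact absurd rfl (h v huv).2

/-! ### Quasi-cubes as initial segments -/

/-- The integers among the first `m` in the ordering `0 ≺ 1 ≺ -1 ≺ ⋯`. -/
noncomputable def rankBall (m : ℕ) : Finset ℤ := (Finset.range m).map intRankEquiv.symm.toEmbedding

theorem mem_rankBall {m : ℕ} {a : ℤ} : a ∈ rankBall m ↔ intRank a < m := by
  simp only [rankBall, Finset.mem_map_equiv, Equiv.symm_symm, Finset.mem_range]
  rfl

theorem card_rankBall (m : ℕ) : (rankBall m).card = m := by
  simp [rankBall]

/-- The box in `ℤ^k` whose first `i` sides consist of the first `m` integers and whose other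
sides consist of the first `m + 1` integers. -/
noncomputable def rankBox (k m i : ℕ) : Finset (Fin k → ℤ) :=
  Fintype.piFinset fun j => rankBall (if (j : ℕ) < i then m else m + 1)

theorem mem_rankBox {k m i : ℕ} {v : Fin k → ℤ} :
    v ∈ rankBox k m i ↔ ∀ j : Fin k, intRank (v j) < if (j : ℕ) < i then m else m + 1 := by
  simp [rankBox, Fintype.mem_piFinset, mem_rankBall]

theorem card_rankBox {k i : ℕ} (m : ℕ) (hi : i ≤ k) : (rankBox k m i).card = quasiCube k m i := by
  have h : Finset.card (Finset.univ.filter fun j : Fin k => (j : ℕ) < i) = i := by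
    rw [Fin.card_filter_val_lt, min_eq_right hi]
  have h' : Finset.card (Finset.univ.filter fun j : Fin k => ¬ (j : ℕ) < i) = k - i := by
    have := Finset.card_filter_add_card_filter_not (s := (Finset.univ : Finset (Fin k)))
      (fun j : Fin k => (j : ℕ) < i)
    rw [h, Finset.card_univ, Fintype.card_fin] at this
    omega
  rw [rankBox, Fintype.card_piFinset]
  simp only [card_rankBall]
  rw [Finset.prod_ite, Finset.prod_const, Finset.prod_const, h, h', quasiCube]

/-- Membership depends only on the two leading keys of `≺`, and monotonically; hence these boxes are
initial segments. -/
theorem mem_rankBox_succ_iff {k m i : ℕ} {v : Fin (k + 1) → ℤ} :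
    v ∈ rankBox (k + 1) m i ↔ intRank (maxEntry v) < m ∨
      (intRank (maxEntry v) = m ∧ i ≤ (firstMax v : ℕ)) := by
  rw [mem_rankBox]
  constructor
  · intro h
    have h1 := h (firstMax v)
    rw [apply_firstMax v] at h1
    split_ifs at h1 <;> omega
  · intro h j
    have h1 := intRank_le_maxEntry v j
    split_ifs with hj
    · rcases h with h | ⟨h, hi⟩
      · omega
      · rw [← h]
        exact intRank_lt_of_lt_firstMax (Fin.lt_def.mpr (by omega))
    · omega

theorem isInitialSegment_rankBox (k m i : ℕ) :
    IsInitialSegment (rankBox k m i : Set (Fin k → ℤ)) := by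
  cases k with
  | zero => exact fun v _ u h => h.elim
  | succ k =>
    intro v hv u huv
    rw [Finset.mem_coe, mem_rankBox_succ_iff] at hv ⊢
    rw [prec_succ_iff] at huv
    rcases huv with h | ⟨h, h'⟩ | ⟨h, h', -⟩
    · omega
    · rw [h]; rw [Fin.lt_def] at h'; omega
    · rw [h, h']; exact hv

theorem seg_quasiCube {k i : ℕ} (m : ℕ) (hi : i ≤ k) :
    seg k (quasiCube k m i) = rankBox k m i :=
  ((isInitialSegment_rankBox k m i).eq_seg (Finset.finite_toSet _)
    (by rw [Set.ncard_coe_finset, card_rankBox m hi])).symm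

/-! ### Weights and the layer recursion -/

/-- `3` to the number of zero coordinates. -/
def zeroWeight {α : Type*} [Zero α] [DecidableEq α] {k : ℕ} (x : Fin k → α) : ℕ :=
  ∏ j, if x j = 0 then 3 else 1

theorem zeroWeight_insertNth {α : Type*} [Zero α] [DecidableEq α] {k : ℕ} (i : Fin (k + 1))
    (a : α) (x : Fin k → α) :
    zeroWeight (i.insertNth a x : Fin (k + 1) → α) = (if a = 0 then 3 else 1) * zeroWeight x := by
  simp [zeroWeight, Fin.prod_univ_succAbove _ i]

/-- The set `seg k n` as a finset. -/
noncomputable def segFinset (k n : ℕ) : Finset (Fin k → ℤ) := (finite_seg k n).toFinset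

theorem coe_segFinset (k n : ℕ) : (segFinset k n : Set (Fin k → ℤ)) = seg k n :=
  (finite_seg k n).coe_toFinset

theorem mem_segFinset {k n : ℕ} {v : Fin k → ℤ} : v ∈ segFinset k n ↔ v ∈ seg k n :=
  (finite_seg k n).mem_toFinset

theorem card_segFinset (k n : ℕ) : (segFinset k n).card = (seg k n).ncard := by
  rw [← coe_segFinset, Set.ncard_coe_finset]

theorem IsInitialSegment.eq_segFinset {k n : ℕ} {I : Finset (Fin k → ℤ)}
    (hI : IsInitialSegment (I : Set (Fin k → ℤ))) (hn : I.card = n) : I = segFinset k n := by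
  rw [← Finset.coe_inj, coe_segFinset]
  exact hI.eq_seg I.finite_toSet (by rw [Set.ncard_coe_finset, hn])

/-- The total weight of the first `n` points of `ℤ^k`. -/
noncomputable def profile (k n : ℕ) : ℕ := ∑ x ∈ segFinset k n, zeroWeight x

section Layer

variable {k m : ℕ} {i : Fin (k + 1)} {x : Fin k → ℤ}

theorem intRank_insertNth_le (hx : x ∈ rankBox k m i) (j : Fin (k + 1)) :
    intRank ((i.insertNth (intRankEquiv.symm m) x : Fin (k + 1) → ℤ) j) ≤ m := by
  rcases Fin.eq_self_or_eq_succAbove i j with rfl | ⟨l, rfl⟩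
  · rw [Fin.insertNth_apply_same, intRank_intRankEquiv_symm]
  · rw [Fin.insertNth_apply_succAbove]
    have := mem_rankBox.mp hx l
    split_ifs at this <;> omega

theorem intRank_insertNth_lt (hx : x ∈ rankBox k m i) {j : Fin (k + 1)} (hj : j < i) :
    intRank ((i.insertNth (intRankEquiv.symm m) x : Fin (k + 1) → ℤ) j) < m := by
  rcases Fin.eq_self_or_eq_succAbove i j with rfl | ⟨l, rfl⟩
  · exact absurd hj (lt_irrefl _)
  · rw [Fin.insertNth_apply_succAbove]
    have h1 := mem_rankBox.mp hx l
    rw [Fin.succAbove_lt_iff_castSucc_lt, Fin.lt_def, Fin.val_castSucc] at hj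
    rwa [if_pos hj] at h1

theorem maxEntry_insertNth (hx : x ∈ rankBox k m i) :
    maxEntry (i.insertNth (intRankEquiv.symm m) x : Fin (k + 1) → ℤ) = intRankEquiv.symm m := by
  rw [maxEntry_eq (i := i), Fin.insertNth_apply_same]
  intro j
  rw [Fin.insertNth_apply_same, intRank_intRankEquiv_symm]
  exact intRank_insertNth_le hx j

theorem firstMax_insertNth (hx : x ∈ rankBox k m i) :
    firstMax (i.insertNth (intRankEquiv.symm m) x : Fin (k + 1) → ℤ) = i := by
  refine firstMax_eq (fun j => ?_) (fun j hj => ?_) <;>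
    rw [Fin.insertNth_apply_same, intRank_intRankEquiv_symm]
  · exact intRank_insertNth_le hx j
  · exact intRank_insertNth_lt hx hj

end Layer

-- Past the box with `i + 1` short sides, the next points have first maximal coordinate `i`, with
-- value the integer of rank `m`. Ties are broken by the order of `ℤ^k`, so a copy of an initial
-- segment of `ℤ^k` is added.
open Classical in
theorem segFinset_layer {k m i r : ℕ} (hi : i ≤ k) (hr : r ≤ quasiCube k m i) :
    Disjoint (rankBox (k + 1) m (i + 1)) ((segFinset k r).image fun x =>
        (Fin.insertNth (⟨i, by omega⟩ : Fin (k + 1)) (intRankEquiv.symm m) x : Fin (k + 1) → ℤ)) ∧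
    segFinset (k + 1) (m * quasiCube k m i + r) =
      rankBox (k + 1) m (i + 1) ∪ (segFinset k r).image fun x =>
        (Fin.insertNth (⟨i, by omega⟩ : Fin (k + 1)) (intRankEquiv.symm m) x :
          Fin (k + 1) → ℤ) := by
  set i' : Fin (k + 1) := ⟨i, by omega⟩ with hi'
  have hsub : ∀ x ∈ segFinset k r, x ∈ rankBox k m i' := by
    intro x hx
    have h := seg_mono k hr (mem_segFinset.mp hx)
    rwa [seg_quasiCube m hi, Finset.mem_coe] at h
  have hdisj : Disjoint (rankBox (k + 1) m (i + 1)) ((segFinset k r).image fun x =>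
      (i'.insertNth (intRankEquiv.symm m) x : Fin (k + 1) → ℤ)) := by
    rw [Finset.disjoint_left]
    intro v hv hv'
    obtain ⟨x, hx, rfl⟩ := Finset.mem_image.mp hv'
    rw [mem_rankBox_succ_iff, maxEntry_insertNth (hsub x hx), firstMax_insertNth (hsub x hx),
      intRank_intRankEquiv_symm] at hv
    simp only [hi'] at hv
    omega
  refine ⟨hdisj, (IsInitialSegment.eq_segFinset ?_ ?_).symm⟩
  · intro v hv u huv
    rw [Finset.mem_coe, Finset.mem_union] at hv ⊢
    rcases hv with hv | hv
    · exact Or.inl (isInitialSegment_rankBox _ _ _ v hv u huv)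
    obtain ⟨x, hx, rfl⟩ := Finset.mem_image.mp hv
    rw [prec_succ_iff, maxEntry_insertNth (hsub x hx), firstMax_insertNth (hsub x hx),
      intRank_intRankEquiv_symm, Fin.removeNth_insertNth] at huv
    rw [mem_rankBox_succ_iff]
    rcases huv with h | ⟨h, h'⟩ | ⟨h, h', h3⟩
    · exact Or.inl (Or.inl h)
    · refine Or.inl (Or.inr ⟨by rw [h, intRank_intRankEquiv_symm], ?_⟩)
      rw [Fin.lt_def] at h'
      exact h'
    · refine Or.inr (Finset.mem_image.mpr ⟨(firstMax u).removeNth u, ?_, ?_⟩)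
      · exact mem_segFinset.mpr (isInitialSegment_seg k r x (mem_segFinset.mp hx) _ h3)
      · rw [← h, ← h', ← apply_firstMax u, Fin.insertNth_self_removeNth]
  · rw [Finset.card_union_of_disjoint hdisj, card_rankBox m (by omega), quasiCube_succ_succ,
      Finset.card_image_of_injective _ (Fin.insertNth_right_injective _), card_segFinset]
    rw [ncard_seg_of_le (n := quasiCube k m i) _ hr]
    rw [seg_quasiCube m hi, Set.ncard_coe_finset, card_rankBox m hi]

theorem profile_one (k : ℕ) : profile k 1 = 3 ^ k := by
  have h : rankBox k 0 0 = segFinset k 1 := by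
    refine (isInitialSegment_rankBox k 0 0).eq_segFinset ?_
    rw [card_rankBox 0 (Nat.zero_le k), quasiCube_zero_right]; simp
  have h' : rankBox k 0 0 = {0} := by
    ext v
    simp [mem_rankBox, intRank_eq_zero, funext_iff]
  rw [profile, ← h, h', Finset.sum_singleton]
  simp [zeroWeight]

/-- In the layer rule the inserted coordinate has rank `m ≥ 1`, so it is nonzero and leaves weights
unchanged. -/
theorem isLayered_profile : IsLayered profile where
  zero k := by
    have : segFinset k 0 = ∅ := by ext v; simp [mem_segFinset, seg]
    simp [profile, this]
  one_le k := by
    rw [profile_one, profile_one]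
    exact Nat.pow_le_pow_right (by omega) (Nat.le_succ k)
  dim_zero n := by
    have : segFinset 0 (n + 1) = {0} := by
      ext v
      simp [mem_segFinset, seg, Prec, Subsingleton.elim v 0]
    simp [profile, this, zeroWeight]
  layer k m i r hm hi hr := by
    classical
    obtain ⟨hd, hs⟩ := segFinset_layer hi hr
    have h0 : segFinset (k + 1) (m * quasiCube k m i) = rankBox (k + 1) m (i + 1) := by
      rw [← quasiCube_succ_succ]
      exact ((isInitialSegment_rankBox (k + 1) m (i + 1)).eq_segFinset
        (card_rankBox m (by omega))).symm
    have hne : intRankEquiv.symm m ≠ 0 := fun h => by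
      have := intRank_intRankEquiv_symm m
      rw [h, intRank_eq_zero.mpr rfl] at this
      omega
    rw [profile, profile, profile, hs, Finset.sum_union hd, h0,
      Finset.sum_image (Fin.insertNth_right_injective _).injOn]
    simp [zeroWeight_insertNth, hne]

/-! ### Weights of down-sets -/

/-- Among finite down-sets of `ℕ^k` of a given size, the initial segments have the least total
weight. -/
theorem profile_card_le_sum_zeroWeight (k : ℕ) (A : Finset (Fin k → ℕ))
    (hA : IsLowerSet (A : Set (Fin k → ℕ))) : profile k A.card ≤ ∑ x ∈ A, zeroWeight x := by
  induction k with
  | zero =>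
    rcases A.eq_empty_or_nonempty with rfl | ⟨x, hx⟩
    · simp [isLayered_profile.zero]
    · obtain rfl : A = {x} := by
        ext y; simp [Subsingleton.elim y x, hx]
      rw [Finset.card_singleton, profile_one, Finset.sum_singleton]
      simp [zeroWeight]
  | succ k ih =>
    induction hn : A.card using Nat.strong_induction_on generalizing A with
    | _ n IH =>
    rcases A.eq_empty_or_nonempty with rfl | hne
    · simp [← hn, isLayered_profile.zero]
    obtain ⟨⟨x₀, i⟩, hx₀, hmax⟩ := Finset.exists_max_image
      (A ×ˢ (Finset.univ : Finset (Fin (k + 1)))) (fun p => p.1 p.2)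
      (hne.product Finset.univ_nonempty)
    replace hx₀ : x₀ ∈ A := (Finset.mem_product.mp hx₀).1
    replace hmax : ∀ x ∈ A, ∀ j, x j ≤ x₀ i := fun x hx j =>
      hmax (x, j) (Finset.mem_product.mpr ⟨hx, Finset.mem_univ _⟩)
    set h := x₀ i with hh
    rcases Nat.eq_zero_or_pos h with h0 | hpos
    · have hA0 : A = {x₀} := by
        refine Finset.eq_singleton_iff_unique_mem.mpr ⟨hx₀, fun x hx => funext fun j => ?_⟩
        have h1 := hmax x hx j
        have h2 := hmax x₀ hx₀ j
        omega
      have hx0 : ∀ j, x₀ j = 0 := fun j => by have := hmax x₀ hx₀ j; omega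
      rw [← hn, hA0, Finset.card_singleton, profile_one, Finset.sum_singleton]
      simp [zeroWeight, hx0]
    have hinj : Function.Injective (fun y => (i.insertNth h y : Fin (k + 1) → ℕ)) :=
      Fin.insertNth_right_injective (α := fun _ => ℕ) h
    set S : Finset (Fin k → ℕ) := A.preimage (fun y => i.insertNth h y) hinj.injOn with hS
    have memS : ∀ y, y ∈ S ↔ (i.insertNth h y : Fin (k + 1) → ℕ) ∈ A := fun y =>
      Finset.mem_preimage
    set A' := A.filter fun x => x i ≠ h with hA'
    have htop : (A.filter fun x => ¬ x i ≠ h) = S.image (fun y => i.insertNth h y) := by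
      ext x
      simp only [Finset.mem_filter, not_not, Finset.mem_image, memS]
      constructor
      · rintro ⟨hx, hxi⟩
        have : (i.insertNth h (i.removeNth x) : Fin (k + 1) → ℕ) = x := by
          rw [← hxi, Fin.insertNth_self_removeNth]
        exact ⟨i.removeNth x, by rwa [this], this⟩
      · rintro ⟨y, hy, rfl⟩
        exact ⟨hy, Fin.insertNth_apply_same _ _ _⟩
    have hcard : A'.card + S.card = A.card := by
      rw [← Finset.card_image_of_injective S hinj, ← htop]
      exact Finset.card_filter_add_card_filter_not _
    have hsum : ∑ x ∈ A', zeroWeight x + ∑ y ∈ S, zeroWeight y = ∑ x ∈ A, zeroWeight x := by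
      rw [← Finset.sum_filter_add_sum_filter_not A (fun x => x i ≠ h), htop,
        Finset.sum_image hinj.injOn]
      simp [zeroWeight_insertNth, hpos.ne', hA']
    have hSpos : 0 < S.card := by
      refine Finset.card_pos.mpr ⟨i.removeNth x₀, ?_⟩
      rw [memS, hh, Fin.insertNth_self_removeNth]
      exact hx₀
    have hSlow : IsLowerSet (S : Set (Fin k → ℕ)) := by
      intro y z hzy hy
      rw [Finset.mem_coe, memS] at hy ⊢
      exact hA (Fin.insertNth_le_iff.mpr ⟨by simp, fun j => by simpa using hzy j⟩) hy
    have hA'low : IsLowerSet (A' : Set (Fin (k + 1) → ℕ)) := by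
      intro y z hzy hy
      rw [Finset.mem_coe, Finset.mem_filter] at hy ⊢
      have h1 := hmax y hy.1 i
      have h2 : z i ≤ y i := hzy i
      have h3 := hy.2
      exact ⟨hA hzy hy.1, by omega⟩
    -- Below each point of the top slice, the down-set contains the `h` points with smaller `i`-th
    -- coordinate.
    have hprod : S.card * h ≤ A'.card := by
      rw [← Finset.card_range h, ← Finset.card_product]
      refine Finset.card_le_card_of_injOn (fun p => (i.insertNth p.2 p.1 : Fin (k + 1) → ℕ)) ?_ ?_
      · rintro ⟨y, j⟩ hp
        simp only [Finset.coe_product, Set.mem_prod, Finset.mem_coe, Finset.mem_range] at hp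
        simp only [Finset.mem_coe, hA', Finset.mem_filter, Fin.insertNth_apply_same]
        refine ⟨hA (Fin.insertNth_le_iff.mpr ⟨?_, fun l => ?_⟩) ((memS y).mp hp.1), hp.2.ne⟩
        · simpa using hp.2.le
        · simp
      · rintro ⟨y, j⟩ - ⟨y', j'⟩ - he
        have := Fin.insertNth_injective2 he
        exact Prod.ext this.2 this.1
    -- Here it matters that `h` bounds all coordinates, not only the `i`-th.
    have hSbox : S.card ≤ (h + 1) ^ k := by
      have : S ⊆ Fintype.piFinset fun _ : Fin k => Finset.range (h + 1) := by
        intro y hy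
        rw [Fintype.mem_piFinset]
        intro j
        have := hmax _ ((memS y).mp hy) (i.succAbove j)
        rw [Fin.insertNth_apply_succAbove] at this
        exact Finset.mem_range.mpr (by omega)
      simpa using Finset.card_le_card this
    have h1 := isLayered_profile.shortIncrementBound k h A'.card S.card hpos hprod hSbox
    have h2 := IH A'.card (by omega) A' hA'low rfl
    have h3 := ih S hSlow
    rw [hcard, hn] at h1
    omega

/-! ### Boundaries of initial segments -/

/-- `≺` extends the coordinatewise order of ranks, so initial segments are down-sets in rank
coordinates. -/
theorem prec_of_intRank_le {k : ℕ} {u v : Fin k → ℤ} (h : ∀ j, intRank (u j) ≤ intRank (v j))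
    (hne : u ≠ v) : Prec k u v := by
  induction k with
  | zero => exact absurd (Subsingleton.elim u v) hne
  | succ k ih =>
    have hM : intRank (maxEntry u) ≤ intRank (maxEntry v) := by
      rw [← apply_firstMax u]
      exact (h _).trans (intRank_le_maxEntry v _)
    rw [prec_succ_iff]
    rcases hM.lt_or_eq with hlt | heq
    · exact Or.inl hlt
    replace heq := intRank_injective heq
    have hv : v (firstMax u) = maxEntry v := by
      refine intRank_injective (le_antisymm (intRank_le_maxEntry v _) ?_)
      rw [← heq, ← apply_firstMax u]
      exact h _
    rcases (firstMax_le hv).lt_or_eq with hlt | hfeq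
    · exact Or.inr (Or.inl ⟨heq, hlt⟩)
    refine Or.inr (Or.inr ⟨heq, hfeq.symm, ih (fun j => ?_) fun hrem => hne ?_⟩)
    · rw [hfeq]; exact h _
    · rw [← Fin.insertNth_self_removeNth (firstMax u) u,
        ← Fin.insertNth_self_removeNth (firstMax v) v, apply_firstMax u, apply_firstMax v, hrem,
        hfeq, heq]

theorem mem_of_intRank_le {k : ℕ} {I : Set (Fin k → ℤ)} (hI : IsInitialSegment I)
    {u v : Fin k → ℤ} (hv : v ∈ I) (h : ∀ j, intRank (u j) ≤ intRank (v j)) : u ∈ I := by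
  by_cases huv : u = v
  · rwa [huv]
  · exact hI v hv u (prec_of_intRank_le h huv)

/-- The set `∂A` of a finite set `A` as a finset. -/
noncomputable def boundaryFinset {k : ℕ} (A : Finset (Fin k → ℤ)) : Finset (Fin k → ℤ) :=
  A.biUnion fun a => Fintype.piFinset fun i => Finset.Icc (a i - 1) (a i + 1)

section Boundary

variable {k : ℕ}

theorem mem_boundaryFinset {A : Finset (Fin k → ℤ)} {x : Fin k → ℤ} :
    x ∈ boundaryFinset A ↔ ∃ a ∈ A, ∀ i, a i - 1 ≤ x i ∧ x i ≤ a i + 1 := by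
  simp [boundaryFinset]

theorem coe_boundaryFinset (A : Finset (Fin k → ℤ)) :
    (boundaryFinset A : Set (Fin k → ℤ)) = vertexBoundary (A : Set (Fin k → ℤ)) := by
  ext x
  rw [Finset.mem_coe, mem_boundaryFinset, mem_vertexBoundary_iff]
  refine exists_congr fun a => and_congr_right fun _ => ?_
  rw [pi_norm_le_iff_of_nonneg zero_le_one]
  refine forall_congr' fun i => ?_
  rw [Pi.sub_apply, Int.norm_eq_abs]
  have : |((x i - a i : ℤ) : ℝ)| ≤ 1 ↔ |x i - a i| ≤ 1 := by exact_mod_cast Iff.rfl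
  rw [this, abs_le]
  omega

theorem subset_boundaryFinset (A : Finset (Fin k → ℤ)) : A ⊆ boundaryFinset A := fun a ha =>
  mem_boundaryFinset.mpr ⟨a, ha, fun i => by omega⟩

theorem boundaryFinset_mono {A B : Finset (Fin k → ℤ)} (h : A ⊆ B) :
    boundaryFinset A ⊆ boundaryFinset B := fun x hx => by
  obtain ⟨a, ha, hxa⟩ := mem_boundaryFinset.mp hx
  exact mem_boundaryFinset.mpr ⟨a, h ha, hxa⟩

/-- The points moved to `a` by the map that brings every nonzero integer nearer to `0` by `1`. -/
def outwardFibre (a : ℤ) : Finset ℤ :=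
  if a = 0 then {-1, 0, 1} else if 0 < a then {a + 1} else {a - 1}

theorem card_outwardFibre (a : ℤ) : (outwardFibre a).card = if a = 0 then 3 else 1 := by
  unfold outwardFibre
  split_ifs <;> simp

/-- The boundary of an initial segment has size at most its total weight. -/
theorem card_boundaryFinset_le {I : Finset (Fin k → ℤ)}
    (hI : IsInitialSegment (I : Set (Fin k → ℤ))) :
    (boundaryFinset I).card ≤ ∑ x ∈ I, zeroWeight x := by
  have hsub : boundaryFinset I ⊆
      I.biUnion fun x => Fintype.piFinset fun i => outwardFibre (x i) := by
    intro z hz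
    obtain ⟨a, ha, hza⟩ := mem_boundaryFinset.mp hz
    -- Every integer within `1` of `z i` has rank at least that of `w i`; hence `w` precedes or
    -- equals `a`.
    let w : Fin k → ℤ := fun i => if 0 < z i then z i - 1 else if z i < 0 then z i + 1 else 0
    refine Finset.mem_biUnion.mpr ⟨w, mem_of_intRank_le hI ha fun j => ?_,
      Fintype.mem_piFinset.mpr fun j => ?_⟩
    · have := hza j
      simp only [w, intRank]
      split_ifs <;> omega
    · simp only [w, outwardFibre]
      split_ifs <;> simp <;> omega
  refine (Finset.card_le_card hsub).trans (Finset.card_biUnion_le.trans (le_of_eq ?_))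
  refine Finset.sum_congr rfl fun x _ => ?_
  rw [Fintype.card_piFinset, zeroWeight]
  simp only [card_outwardFibre]

/-! ### Columns and level sets -/

/-- The line of `A` in the direction of the first coordinate over the point `y`. -/
noncomputable def column (A : Finset (Fin (k + 1) → ℤ)) (y : Fin k → ℤ) : Finset ℤ :=
  A.preimage (fun t => (Fin.cons t y : Fin (k + 1) → ℤ)) (Fin.cons_left_injective (α := fun _ => ℤ) y).injOn

theorem mem_column {A : Finset (Fin (k + 1) → ℤ)} {y : Fin k → ℤ} {t : ℤ} :
    t ∈ column A y ↔ (Fin.cons t y : Fin (k + 1) → ℤ) ∈ A := Finset.mem_preimage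

theorem card_eq_sum_card_column {A : Finset (Fin (k + 1) → ℤ)} {T : Finset (Fin k → ℤ)}
    (h : ∀ x ∈ A, Fin.tail x ∈ T) : A.card = ∑ y ∈ T, (column A y).card := by
  rw [Finset.card_eq_sum_card_fiberwise (f := fun x : Fin (k + 1) → ℤ => (Fin.tail x : Fin k → ℤ)) (t := T)
    (fun x hx => h x hx)]
  refine Finset.sum_congr rfl fun y _ => ?_
  symm
  refine Finset.card_bij (fun t _ => (Fin.cons t y : Fin (k + 1) → ℤ)) ?_ ?_ ?_
  · intro t ht
    exact Finset.mem_filter.mpr ⟨mem_column.mp ht, Fin.tail_cons _ _⟩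
  · intro t _ t' _ h
    exact Fin.cons_left_injective (α := fun _ => ℤ) y h
  · intro x hx
    obtain ⟨hx, rfl⟩ := Finset.mem_filter.mp hx
    exact ⟨x 0, mem_column.mpr (by rwa [Fin.cons_self_tail]), Fin.cons_self_tail x⟩

theorem card_add_two_le {X Z : Finset ℤ} (hX : X.Nonempty)
    (h : ∀ t ∈ X, ∀ s, t - 1 ≤ s → s ≤ t + 1 → s ∈ Z) : X.card + 2 ≤ Z.card := by
  have hmin := X.min'_mem hX
  have hmax := X.max'_mem hX
  have hle := X.min'_le_max' hX
  have h1 : X.min' hX - 1 ∉ X := fun hc => by have := X.min'_le _ hc; omega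
  have h2 : X.max' hX + 1 ∉ insert (X.min' hX - 1) X := fun hc => by
    rcases Finset.mem_insert.mp hc with hc | hc
    · omega
    · have := X.le_max' _ hc; omega
  have hsub : insert (X.max' hX + 1) (insert (X.min' hX - 1) X) ⊆ Z := by
    intro s hs
    rcases Finset.mem_insert.mp hs with rfl | hs
    · exact h _ hmax _ (by omega) le_rfl
    rcases Finset.mem_insert.mp hs with rfl | hs
    · exact h _ hmin _ le_rfl (by omega)
    · exact h s hs s (by omega) (by omega)
  have := Finset.card_le_card hsub
  rw [Finset.card_insert_of_notMem h2, Finset.card_insert_of_notMem h1] at this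
  exact this

/-- The points over which `A` has more than `j` points. -/
noncomputable def levelSet (A : Finset (Fin (k + 1) → ℤ)) (j : ℕ) : Finset (Fin k → ℤ) :=
  (A.image Fin.tail).filter fun y => j < (column A y).card

theorem levelSet_antitone (A : Finset (Fin (k + 1) → ℤ)) : Antitone (levelSet A) := by
  intro i j hij y hy
  rw [levelSet, Finset.mem_filter] at hy ⊢
  exact ⟨hy.1, hij.trans_lt hy.2⟩

theorem tail_mem_levelSet_zero {A : Finset (Fin (k + 1) → ℤ)} {x : Fin (k + 1) → ℤ}
    (hx : x ∈ A) : Fin.tail x ∈ levelSet A 0 := by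
  refine Finset.mem_filter.mpr ⟨Finset.mem_image_of_mem _ hx, Finset.card_pos.mpr ⟨x 0, ?_⟩⟩
  rw [mem_column, Fin.cons_self_tail]
  exact hx

theorem card_column_le (A : Finset (Fin (k + 1) → ℤ)) (y : Fin k → ℤ) :
    (column A y).card ≤ A.card :=
  Finset.card_le_card_of_injOn (fun t => (Fin.cons t y : Fin (k + 1) → ℤ))
    (fun _ ht => mem_column.mp ht) (Fin.cons_left_injective (α := fun _ => ℤ) y).injOn

theorem sum_card_levelSet (A : Finset (Fin (k + 1) → ℤ)) :
    ∑ j ∈ Finset.range A.card, (levelSet A j).card = A.card := by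
  simp only [levelSet, Finset.card_filter]
  rw [Finset.sum_comm]
  conv_rhs => rw [card_eq_sum_card_column (fun x hx => Finset.mem_image_of_mem Fin.tail hx)]
  refine Finset.sum_congr rfl fun y _ => ?_
  rw [← Finset.card_filter]
  have : (Finset.range A.card).filter (fun j => j < (column A y).card) =
      Finset.range (column A y).card := by
    ext j
    have := card_column_le A y
    simp only [Finset.mem_filter, Finset.mem_range]
    omega
  rw [this, Finset.card_range]

/-- Double counting over `∂L_0`: the number of `j` with `y ∈ ∂L_j` is at most the longest column of
`A` adjacent to `y`, and the column of `∂A` over `y` is longer by two. -/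
theorem sum_card_boundaryFinset_levelSet_le (A : Finset (Fin (k + 1) → ℤ)) :
    ∑ j ∈ Finset.range A.card, (boundaryFinset (levelSet A j)).card +
      2 * (boundaryFinset (levelSet A 0)).card ≤ (boundaryFinset A).card := by
  have htail : ∀ x ∈ boundaryFinset A, Fin.tail x ∈ boundaryFinset (levelSet A 0) := by
    intro x hx
    obtain ⟨a, ha, hxa⟩ := mem_boundaryFinset.mp hx
    exact mem_boundaryFinset.mpr ⟨Fin.tail a, tail_mem_levelSet_zero ha, fun i => hxa i.succ⟩
  have hcol : ∀ y ∈ boundaryFinset (levelSet A 0),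
      ((Finset.range A.card).filter fun j => y ∈ boundaryFinset (levelSet A j)).card + 2 ≤
        (column (boundaryFinset A) y).card := by
    intro y hy
    obtain ⟨b, hb, hyb⟩ := mem_boundaryFinset.mp hy
    obtain ⟨c, hc, hmax⟩ := Finset.exists_max_image
      ((levelSet A 0).filter fun b => ∀ i, b i - 1 ≤ y i ∧ y i ≤ b i + 1)
      (fun b => (column A b).card) ⟨b, Finset.mem_filter.mpr ⟨hb, hyb⟩⟩
    obtain ⟨hc, hyc⟩ := Finset.mem_filter.mp hc
    have hcpos : 0 < (column A c).card := (Finset.mem_filter.mp hc).2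
    have h1 : ((Finset.range A.card).filter fun j => y ∈ boundaryFinset (levelSet A j)).card ≤
        (column A c).card := by
      rw [← Finset.card_range (column A c).card]
      refine Finset.card_le_card fun j hj => ?_
      obtain ⟨d, hd, hyd⟩ := mem_boundaryFinset.mp (Finset.mem_filter.mp hj).2
      have hd0 := levelSet_antitone A (Nat.zero_le j) hd
      exact Finset.mem_range.mpr ((Finset.mem_filter.mp hd).2.trans_le
        (hmax d (Finset.mem_filter.mpr ⟨hd0, hyd⟩)))
    have h2 : (column A c).card + 2 ≤ (column (boundaryFinset A) y).card := by
      refine card_add_two_le (Finset.card_pos.mp hcpos) fun t ht s hs hs' => ?_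
      refine mem_column.mpr (mem_boundaryFinset.mpr ⟨_, mem_column.mp ht, fun i => ?_⟩)
      refine Fin.cases ?_ (fun i => ?_) i
      · exact ⟨hs, hs'⟩
      · exact hyc i
    omega
  have hsum := Finset.sum_le_sum hcol
  rw [← card_eq_sum_card_column htail, Finset.sum_add_distrib, Finset.sum_const, smul_eq_mul,
    mul_comm] at hsum
  refine le_trans (Nat.add_le_add_right (le_of_eq ?_) _) hsum
  simp only [Finset.card_filter]
  rw [Finset.sum_comm]
  refine Finset.sum_congr rfl fun j _ => ?_
  rw [← Finset.card_filter, Finset.filter_mem_eq_inter, Finset.inter_eq_right.mpr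
    (boundaryFinset_mono (levelSet_antitone A (Nat.zero_le j)))]

/-- Dimension `0` is included because the induction starts there: `seg 0 n` has at most one point,
but so has `A`. -/
theorem ncard_seg_card (A : Finset (Fin k → ℤ)) : (seg k A.card).ncard = A.card := by
  rcases Nat.eq_zero_or_pos k with rfl | hk
  · refine ncard_seg_of_le (n := quasiCube 0 0 0) ?_ ?_
    · rw [seg_quasiCube 0 le_rfl, Set.ncard_coe_finset, card_rankBox 0 le_rfl]
    · simpa [quasiCube] using Finset.card_le_one_of_subsingleton A
  · exact ncard_seg hk _

end Boundary

/-! ### Compression to a down-set -/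

theorem intRank_comp_injective (k : ℕ) :
    Function.Injective fun (y : Fin k → ℤ) j => intRank (y j) := fun _ _ h =>
  funext fun j => intRank_injective (congrFun h j)

/-- The down-set of `ℕ^(k+1)` whose slices are initial segments of the same sizes as the level
sets of `A`. -/
noncomputable def compression {k : ℕ} (A : Finset (Fin (k + 1) → ℤ)) :
    Finset (Fin (k + 1) → ℕ) :=
  ((Finset.range A.card).sigma fun j => segFinset k (levelSet A j).card).map
    ⟨fun p => Fin.cons p.1 fun i => intRank (p.2 i), by
      rintro ⟨j, y⟩ ⟨j', y'⟩ h
      obtain ⟨rfl, h⟩ := Fin.cons_inj.mp h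
      obtain rfl := intRank_comp_injective k h
      rfl⟩

section Compression

variable {k : ℕ} (A : Finset (Fin (k + 1) → ℤ))

theorem card_compression : (compression A).card = A.card := by
  rw [compression, Finset.card_map, Finset.card_sigma]
  simp only [card_segFinset, ncard_seg_card, sum_card_levelSet]

/-- Level sets shrink as `j` grows, so the slices are nested initial segments, each a down-set in
rank coordinates. -/
theorem isLowerSet_compression : IsLowerSet (compression A : Set (Fin (k + 1) → ℕ)) := by
  intro x z hzx hx
  rw [Finset.mem_coe, compression, Finset.mem_map] at hx ⊢
  obtain ⟨⟨j, y⟩, hp, rfl⟩ := hx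
  obtain ⟨hj, hy⟩ := Finset.mem_sigma.mp hp
  have h0 : z 0 ≤ j := hzx 0
  have hs : ∀ i : Fin k, z i.succ ≤ intRank (y i) := fun i => hzx i.succ
  refine ⟨⟨z 0, fun i => intRankEquiv.symm (z i.succ)⟩, Finset.mem_sigma.mpr ⟨?_, ?_⟩, ?_⟩
  · exact Finset.mem_range.mpr (h0.trans_lt (Finset.mem_range.mp hj))
  · refine mem_segFinset.mpr (seg_mono k (Finset.card_le_card (levelSet_antitone A h0))
      (mem_of_intRank_le (isInitialSegment_seg _ _) (mem_segFinset.mp hy) fun i => ?_))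
    rw [intRank_intRankEquiv_symm]
    exact hs i
  · funext i
    refine Fin.cases rfl (fun i => ?_) i
    exact intRank_intRankEquiv_symm _

theorem zeroWeight_cons_intRank (j : ℕ) (y : Fin k → ℤ) :
    zeroWeight (Fin.cons j fun i => intRank (y i) : Fin (k + 1) → ℕ) =
      (if j = 0 then 3 else 1) * zeroWeight y := by
  simp [zeroWeight, Fin.prod_univ_succ, intRank_eq_zero]

theorem sum_zeroWeight_compression_le :
    ∑ x ∈ compression A, zeroWeight x ≤
      ∑ j ∈ Finset.range A.card, profile k (levelSet A j).card +
        2 * profile k (levelSet A 0).card := by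
  have h : ∑ x ∈ compression A, zeroWeight x = ∑ j ∈ Finset.range A.card,
      (if j = 0 then 3 else 1) * profile k (levelSet A j).card := by
    rw [compression, Finset.sum_map, Finset.sum_sigma]
    refine Finset.sum_congr rfl fun j _ => ?_
    rw [profile, Finset.mul_sum]
    exact Finset.sum_congr rfl fun y _ => zeroWeight_cons_intRank j y
  rw [h]
  cases A.card with
  | zero => simp
  | succ N =>
    -- The slice `j = 0` has factor `3`: once in the sum and twice in the extra term.
    rw [Finset.sum_range_succ', Finset.sum_range_succ']
    simp only [Nat.add_eq_zero_iff, one_ne_zero, and_false, if_false, one_mul, if_true]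
    omega

end Compression

/-! ### The isoperimetric inequality -/

/-- The isoperimetric inequality in terms of the total weight of an initial segment. -/
theorem profile_card_le_card_boundaryFinset (k : ℕ) (A : Finset (Fin k → ℤ)) :
    profile k A.card ≤ (boundaryFinset A).card := by
  induction k with
  | zero =>
    refine le_trans ?_ (Finset.card_le_card (subset_boundaryFinset A))
    rcases A.eq_empty_or_nonempty with rfl | hA
    · simp [isLayered_profile.zero]
    · have h1 := Finset.card_le_one_of_subsingleton A
      have h2 := Finset.card_pos.mpr hA
      rw [show A.card = 1 by omega, profile_one, pow_zero]
  | succ k ih =>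
    calc profile (k + 1) A.card ≤ ∑ x ∈ compression A, zeroWeight x := by
          rw [← card_compression A]
          exact profile_card_le_sum_zeroWeight _ _ (isLowerSet_compression A)
      _ ≤ _ := sum_zeroWeight_compression_le A
      _ ≤ _ := Nat.add_le_add (Finset.sum_le_sum fun j _ => ih _)
          (Nat.mul_le_mul_left 2 (ih _))
      _ ≤ _ := sum_card_boundaryFinset_levelSet_le A

theorem IsInitialSegment.encard_vertexBoundary_le {k : ℕ} {I A : Set (Fin k → ℤ)}
    (hI : IsInitialSegment I) (hA : A.Finite) (hIA : I.encard = A.encard) :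
    (vertexBoundary I).encard ≤ (vertexBoundary A).encard := by
  have hIfin : I.Finite := Set.encard_lt_top_iff.mp (hIA ▸ hA.encard_lt_top)
  lift A to Finset (Fin k → ℤ) using hA
  lift I to Finset (Fin k → ℤ) using hIfin
  rw [Set.encard_coe_eq_coe_finsetCard, Set.encard_coe_eq_coe_finsetCard, Nat.cast_inj] at hIA
  rw [← coe_boundaryFinset, ← coe_boundaryFinset, Set.encard_coe_eq_coe_finsetCard,
    Set.encard_coe_eq_coe_finsetCard, Nat.cast_le]
  calc (boundaryFinset I).card ≤ ∑ x ∈ I, zeroWeight x := card_boundaryFinset_le hI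
    _ = profile k A.card := by rw [profile, ← hI.eq_segFinset hIA]
    _ ≤ _ := profile_card_le_card_boundaryFinset k A

theorem encard_seg {k : ℕ} (hk : 1 ≤ k) (n : ℕ) : (seg k n).encard = n := by
  rw [← (finite_seg k n).cast_ncard_eq, ncard_seg hk]

theorem theorem1 (k : ℕ) (hk : 1 ≤ k) :
    -- `≺` is a well-ordering, with exactly one initial segment of each finite size
    IsWellOrder (Fin k → ℤ) (Prec k) ∧
    (∀ n : ℕ, ∃! I : Set (Fin k → ℤ), IsInitialSegment I ∧ I.encard = n) ∧
    -- the isoperimetric inequality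
    (∀ I A : Set (Fin k → ℤ), IsInitialSegment I → A.Finite → A.Nonempty →
      I.encard = A.encard → (vertexBoundary I).encard ≤ (vertexBoundary A).encard) ∧
    -- nested optimal sets
    (∃ S : ℕ → Set (Fin k → ℤ), Monotone S ∧ ∀ n : ℕ,
      IsInitialSegment (S n) ∧ (S n).encard = n ∧
      ∀ A : Set (Fin k → ℤ), A.encard = n →
        (vertexBoundary (S n)).encard ≤ (vertexBoundary A).encard) := by
  refine ⟨isWellOrder_prec k, fun n => ⟨seg k n, ⟨isInitialSegment_seg k n, encard_seg hk n⟩, ?_⟩,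
    fun I A hI hA _ hIA => hI.encard_vertexBoundary_le hA hIA,
    seg k, seg_mono k, fun n => ⟨isInitialSegment_seg k n, encard_seg hk n, fun A hA => ?_⟩⟩
  · rintro I ⟨hI, hn⟩
    exact hI.eq_seg (Set.finite_of_encard_eq_coe hn) (by rw [Set.ncard, hn, ENat.toNat_natCast])
  · exact (isInitialSegment_seg k n).encard_vertexBoundary_le (Set.finite_of_encard_eq_coe hA)
      (by rw [encard_seg hk, hA])
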